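/- Let $\mathbb{H}=\{(x_1,x_2)\in\mathbb{Z}^2 : x_2\ge 0\}$ and $L_n=\{(k,n): k\in\mathbb{Z}\}$. For $B\subset\mathbb{H}$, $x\in B$ and $N\in\mathbb{N}$ put $$\bar{\mathcal H}_{B,N}(x)=\sum_{z\in L_N\setminus B}P_z\left(S_{\bar\tau_{B\cup L_0}}=x\right),$$ where under $P_z$ the process $(S_n)_{n\ge 0}$ is the simple random walk on $\mathbb{Z}^2$ started at $z$ and $\bar\tau_A=\min\{n\ge 0: S_n\in A\}$ is the first hitting time of $A$. Let $\bar{\mathcal H}_B(x)=\lim_{N\to\infty}\bar{\mathcal H}_{B,N}(x)$ be the stationary harmonic measure of $x$ with respect to $B$. Theorem. Let $B\subset\mathbb{H}$ be nonempty, and suppose that there is a real number $\alpha>1$ such that $$\left|B\setminus\{x\in\mathbb{H} : x_2\le |x_1|^{1/\alpha}\}\right|<\infty .$$ Then there is some $x\in B$ for which the limit $\bar{\mathcal H}_B(x)$ exists, is finite, and satisfies $\bar{\mathcal H}_B(x)>0$. -/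

import Mathlib

open MeasureTheory Filter Topology
open scoped NNReal ENNReal

namespace StationaryHM

/-- The upper half planar lattice, including the horizontal axis. -/
def halfPlane : Set (ℤ × ℤ) := {x | 0 ≤ x.2}

/-- The horizontal line of height `n`. -/
def line (n : ℤ) : Set (ℤ × ℤ) := {x | x.2 = n}

/-- The four unit steps of the nearest neighbour lattice. -/
def unitStep : Fin 4 → ℤ × ℤ := ![(1, 0), (-1, 0), (0, 1), (0, -1)]

/-- The uniform law on the four unit steps. -/
noncomputable def stepLaw : Measure (Fin 4) := (PMF.uniformOfFintype (Fin 4)).toMeasure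

instance : IsProbabilityMeasure stepLaw := by
  unfold stepLaw; infer_instance

/-- The law of an i.i.d. sequence of uniformly distributed unit steps. -/
noncomputable def walkLaw : Measure (ℕ → Fin 4) := Measure.infinitePi (fun _ : ℕ => stepLaw)

/-- The position at time `n` of the simple random walk started at `z`, driven by the steps `ω`. -/
def walk (z : ℤ × ℤ) (n : ℕ) (ω : ℕ → Fin 4) : ℤ × ℤ :=
  z + ∑ i ∈ Finset.range n, unitStep (ω i)

/-- The first time `n ≥ 0` at which the walk started at `z` is in `A` (`⊤` if there is none). -/
noncomputable def hitTime (z : ℤ × ℤ) (A : Set (ℤ × ℤ)) (ω : ℕ → Fin 4) : WithTop ℕ :=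
  hittingAfter (walk z) A 0 ω

/-- The probability that the walk started at `z` ever visits `A` and is at `x` at its first
visit to `A`. -/
noncomputable def hitProb (z : ℤ × ℤ) (A : Set (ℤ × ℤ)) (x : ℤ × ℤ) : ℝ≥0∞ :=
  walkLaw {ω | ∃ n : ℕ, hitTime z A ω = WithTop.some n ∧ walk z n ω = x}

/-- The harmonic measure of `x` with respect to `B` from level `N`: the expected number of walks
that first enter `B ∪ line 0` at `x`, one walk being started from every site of level `N`
outside `B`. -/
noncomputable def harmonicMeasureFrom (B : Set (ℤ × ℤ)) (N : ℕ) (x : ℤ × ℤ) : ℝ≥0∞ :=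
  ∑' z : ↥(line (N : ℤ) \ B), hitProb z.1 (B ∪ line 0) x

/-- The stationary harmonic measure of `x` with respect to `B` exists and is the finite
number `h`: the harmonic measures from level `N` converge to `h` as `N → ∞`. -/
def HasStationaryHarmonicMeasure (B : Set (ℤ × ℤ)) (x : ℤ × ℤ) (h : ℝ≥0) : Prop :=
  Tendsto (fun N : ℕ => harmonicMeasureFrom B N x) atTop (𝓝 (h : ℝ≥0∞))

end StationaryHM

/-!
The walk is reversible: with `T f = 1_{Aᶜ} * avg f` the transition operator of the walk killed on
`A = B ∪ line 0`, the probability of first entering `A` from `z` at time `n`, in the point `x`, is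
`Tⁿ δ_x (z)` (`hitAt_zero`, `hitAt_succ`). Hence the harmonic measure of `x` from level `N` is the
expected number of visits to that level by the killed walk started from the neighbours of `x`
(`harmonicMeasureFrom_eq_lineGreen`). Everything else is summation by parts of `Tⁿ f` against
suitable functions, using that `avg` is symmetric (`pairing_avg`).

*Existence of the limit.* Testing with the indicator function of the sites above height `N` shows
that a walk started no higher than `N` visits level `N + 1` no more often than level `N` in the
mean (`lineGreen_succ_le`), and testing with the height cut off at `N` shows that these mean
numbers are finite (`lineGreen_le`). So the harmonic measures from level `N` are eventually
nonincreasing and finite.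

*Positivity.* Suppose that `W` is nonnegative, superharmonic off `A`, and at least the height on
`A`. Testing with the difference of the cut-off height and `W` bounds the number of visits to
level `N` from below by four times the mean excess of the initial height over `W`, for all large
`N` (`pairing_cutHeight_le`). Such a `W` is built by superposing, over the dyadic frequencies
`b = 2⁻ᵏ`, the discrete harmonic functions `1 - ρ(b) ^ |z₂| cos (b z₁)` with weights `b ^ (-β)`,
where `β = 1 / α < 1`: it is at least a multiple of `|z₁| ^ β` (`rpow_le_barrier`), hence after
scaling and adding a constant at least the height on `B`, and it is `o(M)` at `(0, M)`
(`eventually_barrier_lt`). So the excess at `(0, M)` is positive for large `M`. Finally, if `x` is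
the highest site of `B` in some column, the walk leaving `x` can reach `(0, M)` without meeting
`A`, going up in that column and then along the row of height `M`, and so the limit at `x`
is positive.
-/

namespace StationaryHM

/-! ### First-step analysis of the walk -/

instance : IsProbabilityMeasure walkLaw := by
  unfold walkLaw
  infer_instance

/-- Prepend a step to a sequence of steps. -/
def consStep (p : Fin 4 × (ℕ → Fin 4)) : ℕ → Fin 4
  | 0 => p.1
  | n + 1 => p.2 n

lemma measurable_consStep : Measurable consStep := by
  refine measurable_pi_lambda _ fun n => ?_
  cases n with
  | zero => exact measurable_fst
  | succ n => exact (measurable_pi_apply n).comp measurable_snd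

/-- The first step is uniform and independent of the later ones, which again form an
i.i.d. sequence of uniform steps. -/
lemma map_consStep : (stepLaw.prod walkLaw).map consStep = walkLaw := by
  refine Measure.eq_infinitePi _ fun s t ht => ?_
  classical
  rw [Measure.map_apply measurable_consStep (.pi s.countable_toSet fun i _ => ht i)]
  -- Outside `s` replace `t` by the whole space, so that `s` becomes an initial segment.
  obtain ⟨n, hn⟩ : ∃ n, s ⊆ Finset.range (n + 1) :=
    ⟨s.sup id, fun i hi => Finset.mem_range_succ_iff.2 (Finset.le_sup (f := id) hi)⟩
  set t' : ℕ → Set (Fin 4) := fun i => if i ∈ s then t i else Set.univ with ht'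
  have hprod : ∏ i ∈ s, stepLaw (t i) = ∏ i ∈ Finset.range (n + 1), stepLaw (t' i) := by
    rw [← Finset.prod_subset hn (f := fun i => stepLaw (t' i))]
    · exact Finset.prod_congr rfl fun i hi => by simp [ht', hi]
    · intro i _ hi
      simp [ht', hi]
  have hset : consStep ⁻¹' (Set.pi s t) =
      t' 0 ×ˢ Set.pi (Finset.range n : Finset ℕ) (fun i => t' (i + 1)) := by
    ext ⟨e, ω⟩
    simp only [Set.mem_preimage, Set.mem_pi, Set.mem_prod, Finset.mem_coe, Finset.mem_range]
    constructor
    · intro h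
      refine ⟨?_, fun i _ => ?_⟩
      · by_cases h0 : 0 ∈ s
        · simpa [ht', h0, consStep] using h 0 h0
        · simp [ht', h0]
      · by_cases h0 : i + 1 ∈ s
        · simpa [ht', h0, consStep] using h (i + 1) h0
        · simp [ht', h0]
    · rintro ⟨h0, h1⟩ i hi
      cases i with
      | zero => simpa [ht', hi, consStep] using h0
      | succ i =>
        have := h1 i (by have := Finset.mem_range.1 (hn hi); omega)
        simpa [ht', hi, consStep] using this
  rw [hprod, hset, Measure.prod_prod, Finset.prod_range_succ', mul_comm]
  congr 1
  exact Measure.infinitePi_pi _ fun i _ => .of_discrete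

lemma stepLaw_singleton (e : Fin 4) : stepLaw {e} = 4⁻¹ := by
  simp [stepLaw]

lemma walk_consStep (z : ℤ × ℤ) (n : ℕ) (e : Fin 4) (ω : ℕ → Fin 4) :
    walk z (n + 1) (consStep (e, ω)) = walk (z + unitStep e) n ω := by
  simp only [walk, Finset.sum_range_succ', consStep]
  abel

lemma measurable_walk (z : ℤ × ℤ) (n : ℕ) : Measurable (walk z n) := by
  unfold walk
  refine measurable_const.add (Finset.measurable_sum _ fun i _ => ?_)
  exact (measurable_of_countable unitStep).comp (measurable_pi_apply i)

/-- The event that the walk started at `z` first enters `A` at time `n`, in the point `x`. -/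
def hitEvent (A : Set (ℤ × ℤ)) (x : ℤ × ℤ) (n : ℕ) (z : ℤ × ℤ) : Set (ℕ → Fin 4) :=
  {ω | hitTime z A ω = WithTop.some n ∧ walk z n ω = x}

lemma hitTime_eq_iff (z : ℤ × ℤ) (A : Set (ℤ × ℤ)) (ω : ℕ → Fin 4) (n : ℕ) :
    hitTime z A ω = WithTop.some n ↔ walk z n ω ∈ A ∧ ∀ m < n, walk z m ω ∉ A := by
  classical
  unfold hitTime
  constructor
  · intro h
    have hex : ∃ j, 0 ≤ j ∧ walk z j ω ∈ A := by
      by_contra! hcon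
      rw [hittingAfter_eq_top_iff.2 hcon] at h
      exact absurd h.symm (WithTop.coe_ne_top)
    refine ⟨?_, fun m hm => ?_⟩
    · have := hittingAfter_mem_set hex
      rwa [h] at this
    · refine notMem_of_lt_hittingAfter (n := 0) ?_ (Nat.zero_le m)
      rw [h]
      exact WithTop.coe_lt_coe.2 hm
  · rintro ⟨hA, hlt⟩
    have hex : ∃ j, 0 ≤ j ∧ walk z j ω ∈ A := ⟨n, Nat.zero_le n, hA⟩
    rw [hittingAfter, if_pos hex]
    congr 1
    refine le_antisymm (Nat.sInf_le ⟨Nat.zero_le n, hA⟩) ?_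
    refine le_csInf ⟨n, Nat.zero_le n, hA⟩ ?_
    rintro m ⟨-, hm⟩
    by_contra! hmn
    exact hlt m hmn hm

lemma mem_hitEvent {A : Set (ℤ × ℤ)} {x : ℤ × ℤ} (hx : x ∈ A) {n : ℕ} {z : ℤ × ℤ}
    {ω : ℕ → Fin 4} : ω ∈ hitEvent A x n z ↔ walk z n ω = x ∧ ∀ m < n, walk z m ω ∉ A := by
  rw [hitEvent, Set.mem_ofPred_eq, hitTime_eq_iff]
  constructor
  · rintro ⟨⟨-, h⟩, h'⟩
    exact ⟨h', h⟩
  · rintro ⟨h', h⟩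
    exact ⟨⟨h' ▸ hx, h⟩, h'⟩

lemma measurableSet_hitEvent {A : Set (ℤ × ℤ)} {x : ℤ × ℤ} (hx : x ∈ A) (n : ℕ) (z : ℤ × ℤ) :
    MeasurableSet (hitEvent A x n z) := by
  have : hitEvent A x n z = walk z n ⁻¹' {x} ∩ ⋂ m, ⋂ _ : m < n, walk z m ⁻¹' Aᶜ := by
    ext ω
    rw [mem_hitEvent hx]
    simp
  rw [this]
  exact (measurable_walk z n .of_discrete).inter
    (.iInter fun m => .iInter fun _ => measurable_walk z m .of_discrete)

/-- The probability that the walk started at `z` first enters `A` at time `n`, in the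
point `x`. -/
noncomputable def hitAt (A : Set (ℤ × ℤ)) (x : ℤ × ℤ) (n : ℕ) (z : ℤ × ℤ) : ℝ≥0∞ :=
  walkLaw (hitEvent A x n z)

lemma hitProb_eq_tsum {A : Set (ℤ × ℤ)} {x : ℤ × ℤ} (hx : x ∈ A) (z : ℤ × ℤ) :
    hitProb z A x = ∑' n, hitAt A x n z := by
  have : {ω | ∃ n : ℕ, hitTime z A ω = WithTop.some n ∧ walk z n ω = x} =
      ⋃ n, hitEvent A x n z := by
    ext ω
    simp [hitEvent]
  rw [hitProb, this, measure_iUnion _ fun n => measurableSet_hitEvent hx n z]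
  · rfl
  · intro m n hmn
    refine Set.disjoint_left.2 fun ω hm hn => hmn ?_
    exact WithTop.coe_injective (hm.1.symm.trans hn.1)

/-- The mean of `f` over the four neighbours of a site. -/
noncomputable def avg (f : ℤ × ℤ → ℝ≥0∞) (z : ℤ × ℤ) : ℝ≥0∞ :=
  4⁻¹ * (f (z + (1, 0)) + f (z + (-1, 0)) + f (z + (0, 1)) + f (z + (0, -1)))

/-- The transition operator of the walk killed on `A`. -/
noncomputable def killedStep (A : Set (ℤ × ℤ)) (f : ℤ × ℤ → ℝ≥0∞) : ℤ × ℤ → ℝ≥0∞ :=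
  Aᶜ.indicator (avg f)

lemma hitAt_zero {A : Set (ℤ × ℤ)} {x : ℤ × ℤ} (hx : x ∈ A) :
    hitAt A x 0 = ({x} : Set (ℤ × ℤ)).indicator 1 := by
  ext z
  by_cases hz : z = x
  · have : hitEvent A x 0 z = Set.univ := by
      ext ω
      simp [mem_hitEvent hx, walk, hz]
    rw [hitAt, this, walkLaw, measure_univ]
    simp [hz]
  · have : hitEvent A x 0 z = ∅ := by
      ext ω
      simp [mem_hitEvent hx, walk, hz]
    simp [hitAt, this, hz]

lemma hitAt_succ {A : Set (ℤ × ℤ)} {x : ℤ × ℤ} (hx : x ∈ A) (n : ℕ) :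
    hitAt A x (n + 1) = killedStep A (hitAt A x n) := by
  ext z
  by_cases hz : z ∈ A
  · have : hitEvent A x (n + 1) z = ∅ := by
      ext ω
      simp only [mem_hitEvent hx, Set.mem_empty_iff_false, iff_false, not_and, not_forall]
      exact fun _ => ⟨0, n.succ_pos, by simpa [walk] using hz⟩
    simp [hitAt, this, killedStep, hz]
  · have key : ∀ e : Fin 4, Prod.mk e ⁻¹' (consStep ⁻¹' hitEvent A x (n + 1) z) =
        hitEvent A x n (z + unitStep e) := by
      intro e
      ext ω
      simp only [Set.mem_preimage, mem_hitEvent hx, walk_consStep]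
      refine and_congr_right fun _ => ⟨fun h m hm => ?_, fun h m hm => ?_⟩
      · rw [← walk_consStep]
        exact h (m + 1) (by omega)
      · cases m with
        | zero => simpa [walk] using hz
        | succ m =>
          rw [walk_consStep]
          exact h m (by omega)
    have hm := measurableSet_hitEvent hx (n + 1) z
    rw [hitAt, ← map_consStep, Measure.map_apply measurable_consStep hm,
      Measure.prod_apply (measurable_consStep hm), lintegral_fintype]
    simp only [key, stepLaw_singleton, killedStep, Fin.sum_univ_four]
    rw [Set.indicator_of_mem (by exact hz)]
    simp only [avg, hitAt, mul_comm _ (4⁻¹ : ℝ≥0∞), ← mul_add]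
    simp [unitStep]

/-! ### Potential theory of the killed walk -/

/-- The sum of `φ * f` over the lattice. -/
noncomputable def pairing (φ f : ℤ × ℤ → ℝ≥0∞) : ℝ≥0∞ := ∑' z, φ z * f z

lemma pairing_add_left (φ ψ f : ℤ × ℤ → ℝ≥0∞) :
    pairing (φ + ψ) f = pairing φ f + pairing ψ f := by
  simp only [pairing, Pi.add_apply, add_mul, ENNReal.tsum_add]

lemma pairing_smul_left (c : ℝ≥0∞) (φ f : ℤ × ℤ → ℝ≥0∞) :
    pairing (c • φ) f = c * pairing φ f := by
  simp only [pairing, Pi.smul_apply, smul_eq_mul, mul_assoc, ENNReal.tsum_mul_left]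

lemma pairing_smul_right (c : ℝ≥0∞) (φ f : ℤ × ℤ → ℝ≥0∞) :
    pairing φ (c • f) = c * pairing φ f := by
  simp only [pairing, Pi.smul_apply, smul_eq_mul, mul_left_comm _ c, ENNReal.tsum_mul_left]

lemma pairing_sum_left {ι : Type*} (s : Finset ι) (φ : ι → ℤ × ℤ → ℝ≥0∞) (f : ℤ × ℤ → ℝ≥0∞) :
    pairing (∑ i ∈ s, φ i) f = ∑ i ∈ s, pairing (φ i) f := by
  classical
  induction s using Finset.induction_on with
  | empty => simp [pairing]
  | insert i s hi ih => rw [Finset.sum_insert hi, Finset.sum_insert hi, pairing_add_left, ih]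

lemma pairing_mono {φ ψ f g : ℤ × ℤ → ℝ≥0∞} (hφ : φ ≤ ψ) (hf : f ≤ g) :
    pairing φ f ≤ pairing ψ g :=
  ENNReal.tsum_le_tsum fun z => mul_le_mul' (hφ z) (hf z)

/-- Only the values of `φ` on a set carrying `f` matter for the pairing. -/
lemma pairing_mono_on {φ ψ f : ℤ × ℤ → ℝ≥0∞} {A : Set (ℤ × ℤ)} (hf : ∀ z ∈ A, f z = 0)
    (h : ∀ z ∉ A, φ z ≤ ψ z) : pairing φ f ≤ pairing ψ f := by
  refine ENNReal.tsum_le_tsum fun z => ?_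
  by_cases hz : z ∈ A
  · simp [hf z hz]
  · exact mul_le_mul' (h z hz) le_rfl

lemma pairing_single (φ : ℤ × ℤ → ℝ≥0∞) (y : ℤ × ℤ) :
    pairing φ (({y} : Set (ℤ × ℤ)).indicator 1) = φ y := by
  rw [pairing, tsum_eq_single y]
  · simp
  · intro z hz
    simp [hz]

/-- The simple random walk is reversible. -/
lemma pairing_avg (φ f : ℤ × ℤ → ℝ≥0∞) : pairing φ (avg f) = pairing (avg φ) f := by
  have shift : ∀ e : ℤ × ℤ, ∑' z, φ z * f (z + e) = ∑' z, φ (z + -e) * f z := by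
    intro e
    rw [← (Equiv.addRight e).tsum_eq (fun z => φ (z + -e) * f z)]
    simp
  have h1 : pairing φ (avg f) = 4⁻¹ * (∑' z, φ z * f (z + (1, 0)) + ∑' z, φ z * f (z + (-1, 0)) +
      ∑' z, φ z * f (z + (0, 1)) + ∑' z, φ z * f (z + (0, -1))) := by
    simp only [pairing, avg, ← ENNReal.tsum_add, ← ENNReal.tsum_mul_left]
    exact tsum_congr fun z => by ring
  have h2 : pairing (avg φ) f = 4⁻¹ * (∑' z, φ (z + (1, 0)) * f z + ∑' z, φ (z + (-1, 0)) * f z +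
      ∑' z, φ (z + (0, 1)) * f z + ∑' z, φ (z + (0, -1)) * f z) := by
    simp only [pairing, avg, ← ENNReal.tsum_add, ← ENNReal.tsum_mul_left]
    exact tsum_congr fun z => by ring
  rw [h1, h2, shift, shift, shift, shift]
  simp only [Prod.neg_mk, neg_neg, neg_zero]
  congr 1
  ring

lemma killedStep_le (A : Set (ℤ × ℤ)) (f : ℤ × ℤ → ℝ≥0∞) : killedStep A f ≤ avg f :=
  Set.indicator_le_self _ _

lemma killedStep_of_mem {A : Set (ℤ × ℤ)} {f : ℤ × ℤ → ℝ≥0∞} {z : ℤ × ℤ} (hz : z ∈ A) :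
    killedStep A f z = 0 := by
  simp [killedStep, hz]

lemma avg_smul (c : ℝ≥0∞) (f : ℤ × ℤ → ℝ≥0∞) : avg (c • f) = c • avg f := by
  ext z
  simp only [avg, Pi.smul_apply, smul_eq_mul]
  ring

lemma avg_mono {f g : ℤ × ℤ → ℝ≥0∞} (h : f ≤ g) : avg f ≤ avg g := fun z => by
  unfold avg
  gcongr <;> exact h _

lemma killedStep_smul (A : Set (ℤ × ℤ)) (c : ℝ≥0∞) (f : ℤ × ℤ → ℝ≥0∞) :
    killedStep A (c • f) = c • killedStep A f := by
  rw [killedStep, avg_smul]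
  exact Set.indicator_const_smul Aᶜ c (avg f)

lemma killedStep_mono (A : Set (ℤ × ℤ)) {f g : ℤ × ℤ → ℝ≥0∞} (h : f ≤ g) :
    killedStep A f ≤ killedStep A g :=
  fun _ => Set.indicator_le_indicator (avg_mono h _)

lemma iterate_killedStep_smul (A : Set (ℤ × ℤ)) (c : ℝ≥0∞) (f : ℤ × ℤ → ℝ≥0∞) (n : ℕ) :
    (killedStep A)^[n] (c • f) = c • (killedStep A)^[n] f := by
  induction n with
  | zero => rfl
  | succ n ih =>
    rw [Function.iterate_succ_apply', ih, killedStep_smul, Function.iterate_succ_apply']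

lemma iterate_killedStep_mono (A : Set (ℤ × ℤ)) {f g : ℤ × ℤ → ℝ≥0∞} (h : f ≤ g) (n : ℕ) :
    (killedStep A)^[n] f ≤ (killedStep A)^[n] g := by
  induction n with
  | zero => exact h
  | succ n ih => simpa only [Function.iterate_succ_apply'] using killedStep_mono A ih

lemma iterate_killedStep_of_mem {A : Set (ℤ × ℤ)} {f : ℤ × ℤ → ℝ≥0∞} (hf : ∀ z ∈ A, f z = 0)
    (n : ℕ) : ∀ z ∈ A, (killedStep A)^[n] f z = 0 := by
  cases n with
  | zero => exact hf
  | succ n =>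
    intro z hz
    rw [Function.iterate_succ_apply']
    exact killedStep_of_mem hz

/-- A killed step does not increase the pairing with a function superharmonic off `A`. -/
lemma pairing_killedStep_le {A : Set (ℤ × ℤ)} {W f : ℤ × ℤ → ℝ≥0∞} (hf : ∀ z ∈ A, f z = 0)
    (hW : ∀ z ∉ A, avg W z ≤ W z) : pairing W (killedStep A f) ≤ pairing W f :=
  calc pairing W (killedStep A f) ≤ pairing W (avg f) := pairing_mono le_rfl (killedStep_le A f)
    _ = pairing (avg W) f := pairing_avg W f
    _ ≤ pairing W f := pairing_mono_on hf hW

lemma pairing_iterate_le {A : Set (ℤ × ℤ)} {W f : ℤ × ℤ → ℝ≥0∞} (hf : ∀ z ∈ A, f z = 0)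
    (hW : ∀ z ∉ A, avg W z ≤ W z) (n : ℕ) : pairing W ((killedStep A)^[n] f) ≤ pairing W f := by
  induction n with
  | zero => exact le_rfl
  | succ n ih =>
    rw [Function.iterate_succ_apply']
    exact (pairing_killedStep_le (iterate_killedStep_of_mem hf n) hW).trans ih

/-! ### Height functions -/

/-- The indicator function of the line of height `N`. -/
noncomputable def level (N : ℕ) : ℤ × ℤ → ℝ≥0∞ := (line (N : ℤ)).indicator 1

/-- The indicator function of the sites strictly above height `N`. -/
noncomputable def above (N : ℕ) : ℤ × ℤ → ℝ≥0∞ := {z : ℤ × ℤ | (N : ℤ) < z.2}.indicator 1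

/-- The height of a site, cut off below at `0` and above at `N`. -/
noncomputable def cutHeight (N : ℕ) (z : ℤ × ℤ) : ℝ≥0∞ := ((min z.2.toNat N : ℕ) : ℝ≥0∞)

lemma avg_natCast (g : ℤ → ℕ) (z : ℤ × ℤ) :
    avg (fun y => (g y.2 : ℝ≥0∞)) z =
      4⁻¹ * ((2 * g z.2 + g (z.2 + 1) + g (z.2 - 1) : ℕ) : ℝ≥0∞) := by
  simp only [avg, Prod.snd_add, add_zero]
  push_cast
  rw [← sub_eq_add_neg]
  ring

lemma level_eq_natCast (N : ℕ) :
    level N = fun y => (((if y.2 = (N : ℤ) then 1 else 0 : ℕ)) : ℝ≥0∞) := by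
  ext z
  by_cases h : z.2 = N <;> simp [level, line, h]

lemma above_eq_natCast (N : ℕ) :
    above N = fun y => (((if (N : ℤ) < y.2 then 1 else 0 : ℕ)) : ℝ≥0∞) := by
  ext z
  by_cases h : (N : ℤ) < z.2 <;> simp [above, h]

lemma eq_four_inv_mul (n : ℕ) : (n : ℝ≥0∞) = 4⁻¹ * ((4 * n : ℕ) : ℝ≥0∞) := by
  push_cast
  rw [← mul_assoc, ENNReal.inv_mul_cancel (by norm_num) (by norm_num), one_mul]

/-- The cut-off height is harmonic off the lines of height `0` and `N`. -/
lemma avg_cutHeight_add {N : ℕ} (hN : 1 ≤ N) {z : ℤ × ℤ} (hz : z.2 ≠ 0) :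
    avg (cutHeight N) z + 4⁻¹ * level N z = cutHeight N z := by
  have h := avg_natCast (fun k => min k.toNat N) z
  rw [show avg (cutHeight N) z = _ from h, level_eq_natCast, cutHeight, ← mul_add, ← Nat.cast_add,
    eq_four_inv_mul (min z.2.toNat N)]
  congr 2
  split_ifs with h <;> omega

/-- The balance of `above N` under averaging: `level N` flows up and `level (N + 1)` down. -/
lemma avg_above_add (N : ℕ) (z : ℤ × ℤ) :
    avg (above N) z + 4⁻¹ * level (N + 1) z = above N z + 4⁻¹ * level N z := by
  have h := avg_natCast (fun k => if (N : ℤ) < k then 1 else 0) z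
  rw [above_eq_natCast, h, level_eq_natCast, level_eq_natCast, ← mul_add, ← Nat.cast_add]
  simp only
  rw [eq_four_inv_mul (if (N : ℤ) < z.2 then 1 else 0), ← mul_add, ← Nat.cast_add]
  congr 2
  push_cast
  split_ifs <;> omega

/-! ### Green's function summed over a line -/

/-- The expected number of visits to the line of height `N` before `A` is hit, for a walk
with initial distribution `f` (a finite or infinite measure, meant to be carried by `Aᶜ`). -/
noncomputable def lineGreen (A : Set (ℤ × ℤ)) (N : ℕ) (f : ℤ × ℤ → ℝ≥0∞) : ℝ≥0∞ :=
  ∑' n, pairing (level N) ((killedStep A)^[n] f)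

section

variable {A : Set (ℤ × ℤ)} {f : ℤ × ℤ → ℝ≥0∞}

lemma lineGreen_le (hA : line 0 ⊆ A) (hf : ∀ z ∈ A, f z = 0) {N : ℕ} (hN : 1 ≤ N) :
    4⁻¹ * lineGreen A N f ≤ pairing (cutHeight N) f := by
  have key : ∀ m, pairing (cutHeight N) ((killedStep A)^[m] f) +
      ∑ n ∈ Finset.range m, 4⁻¹ * pairing (level N) ((killedStep A)^[n] f) ≤
        pairing (cutHeight N) f := by
    intro m
    induction m with
    | zero => simp
    | succ m ih =>
      refine le_trans ?_ ih
      rw [Finset.sum_range_succ, add_left_comm,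
        add_comm (pairing (cutHeight N) ((killedStep A)^[m] f))]
      refine add_le_add_right ?_ _
      rw [Function.iterate_succ_apply', ← pairing_smul_left]
      calc _ ≤ pairing (cutHeight N) (avg ((killedStep A)^[m] f)) +
            pairing ((4⁻¹ : ℝ≥0∞) • level N) ((killedStep A)^[m] f) := by
              gcongr
              exact pairing_mono le_rfl (killedStep_le _ _)
        _ = pairing (avg (cutHeight N) + (4⁻¹ : ℝ≥0∞) • level N) ((killedStep A)^[m] f) := by
              rw [pairing_avg, pairing_add_left]
        _ ≤ _ := pairing_mono_on (iterate_killedStep_of_mem hf m) fun z hz =>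
              (avg_cutHeight_add hN fun h => hz (hA h)).le
  rw [lineGreen, ← ENNReal.tsum_mul_left]
  exact ENNReal.tsum_le_of_sum_range_le fun m => le_add_self.trans (key m)

/-- A walk started no higher than `N` visits the line `N + 1` no more often than the line `N`,
in the mean. -/
lemma lineGreen_succ_le {N : ℕ} (hfN : ∀ z, (N : ℤ) < z.2 → f z = 0) :
    lineGreen A (N + 1) f ≤ lineGreen A N f := by
  have h0 : pairing (above N) f = 0 := by
    refine ENNReal.tsum_eq_zero.2 fun z => ?_
    by_cases hz : (N : ℤ) < z.2
    · simp [hfN z hz]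
    · simp [above, hz]
  have key : ∀ m, pairing (above N) ((killedStep A)^[m] f) +
      ∑ n ∈ Finset.range m, 4⁻¹ * pairing (level (N + 1)) ((killedStep A)^[n] f) ≤
        ∑ n ∈ Finset.range m, 4⁻¹ * pairing (level N) ((killedStep A)^[n] f) := by
    intro m
    induction m with
    | zero => simp [h0]
    | succ m ih =>
      set g := (killedStep A)^[m] f with hg
      have step : pairing (above N) (killedStep A g) + 4⁻¹ * pairing (level (N + 1)) g ≤
          pairing (above N) g + 4⁻¹ * pairing (level N) g := by
        rw [← pairing_smul_left, ← pairing_smul_left, ← pairing_add_left]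
        calc _ ≤ pairing (above N) (avg g) + pairing ((4⁻¹ : ℝ≥0∞) • level (N + 1)) g := by
              gcongr
              exact pairing_mono le_rfl (killedStep_le _ _)
          _ = pairing (avg (above N) + (4⁻¹ : ℝ≥0∞) • level (N + 1)) g := by
              rw [pairing_avg, pairing_add_left]
          _ ≤ _ := pairing_mono (fun z => (avg_above_add N z).le) le_rfl
      rw [Finset.sum_range_succ, Finset.sum_range_succ, Function.iterate_succ_apply', ← hg]
      calc _ = (pairing (above N) (killedStep A g) + 4⁻¹ * pairing (level (N + 1)) g) +
            ∑ n ∈ Finset.range m, 4⁻¹ * pairing (level (N + 1)) ((killedStep A)^[n] f) := by ring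
        _ ≤ (pairing (above N) g + 4⁻¹ * pairing (level N) g) +
            ∑ n ∈ Finset.range m, 4⁻¹ * pairing (level (N + 1)) ((killedStep A)^[n] f) := by gcongr
        _ = (pairing (above N) g +
            ∑ n ∈ Finset.range m, 4⁻¹ * pairing (level (N + 1)) ((killedStep A)^[n] f)) +
              4⁻¹ * pairing (level N) g := by ring
        _ ≤ _ := by gcongr
  have h : 4⁻¹ * lineGreen A (N + 1) f ≤ 4⁻¹ * lineGreen A N f := by
    rw [lineGreen, lineGreen, ← ENNReal.tsum_mul_left, ← ENNReal.tsum_mul_left]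
    exact ENNReal.tsum_le_of_sum_range_le fun m =>
      (le_add_self.trans (key m)).trans (ENNReal.sum_le_tsum _)
  exact (ENNReal.mul_le_mul_iff_right (by norm_num) (by norm_num)).1 h

/-- The cut-off height of the killed walk tends to zero in the mean: each line is visited
finitely often in the mean, and high lines are unlikely to be reached at all. -/
lemma tendsto_pairing_cutHeight (hA : line 0 ⊆ A) (hf : ∀ z ∈ A, f z = 0) {C : ℝ≥0∞} (hC : C ≠ ⊤)
    (hfC : ∀ N, pairing (cutHeight N) f ≤ C) (N : ℕ) :
    Tendsto (fun m => pairing (cutHeight N) ((killedStep A)^[m] f)) atTop (𝓝 0) := by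
  have hlevel : ∀ j, Tendsto (fun m => pairing (level (j + 1)) ((killedStep A)^[m] f)) atTop
      (𝓝 0) := by
    intro j
    refine ENNReal.tendsto_atTop_zero_of_tsum_ne_top ?_
    have h := (lineGreen_le hA hf (Nat.le_add_left 1 j)).trans (hfC (j + 1))
    intro htop
    rw [lineGreen, htop, ENNReal.mul_top (by norm_num)] at h
    exact hC (top_le_iff.1 h)
  have hsup : ∀ J, ∀ z ∉ A, avg (cutHeight (J + 1)) z ≤ cutHeight (J + 1) z := fun J z hz =>
    le_self_add.trans (avg_cutHeight_add (Nat.le_add_left 1 J) fun h => hz (hA h)).le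
  -- Split `cutHeight N` at height `J`.
  have hsplit : ∀ J, cutHeight N ≤ (N : ℝ≥0∞) • ∑ j ∈ Finset.range J, level (j + 1) +
      ((N : ℝ≥0∞) * ((J + 1 : ℕ) : ℝ≥0∞)⁻¹) • cutHeight (J + 1) := by
    intro J z
    simp only [Pi.add_apply, Pi.smul_apply, smul_eq_mul, Finset.sum_apply]
    have hN : cutHeight N z ≤ N := by
      simp only [cutHeight]
      exact_mod_cast min_le_right _ _
    rcases le_or_gt z.2 0 with h0 | h0
    · simp [cutHeight, Int.toNat_of_nonpos h0]
    rcases le_or_gt z.2 J with hJ | hJ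
    · refine le_trans ?_ le_self_add
      have h1 : level (z.2.toNat - 1 + 1) z = 1 := by
        have : z.2 = ((z.2.toNat - 1 + 1 : ℕ) : ℤ) := by omega
        rw [level, Set.indicator_of_mem (by exact this)]
        rfl
      have h2 := Finset.single_le_sum (f := fun j => level (j + 1) z) (fun j _ => zero_le)
        (Finset.mem_range.2 (show z.2.toNat - 1 < J by omega))
      simp only [h1] at h2
      calc _ ≤ (N : ℝ≥0∞) * 1 := by simpa using hN
        _ ≤ _ := by gcongr
    · refine le_trans ?_ le_add_self
      have h1 : cutHeight (J + 1) z = ((J + 1 : ℕ) : ℝ≥0∞) := by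
        rw [cutHeight, min_eq_right (by omega)]
      rw [h1, mul_assoc, ENNReal.inv_mul_cancel (by simp) (ENNReal.natCast_ne_top _), mul_one]
      exact hN
  rw [ENNReal.tendsto_atTop_zero]
  intro ε hε
  have hJ : Tendsto (fun J : ℕ => (N : ℝ≥0∞) * ((J + 1 : ℕ) : ℝ≥0∞)⁻¹ * C) atTop (𝓝 0) := by
    have h := (tendsto_add_atTop_iff_nat 1).2 ENNReal.tendsto_inv_nat_nhds_zero
    have h' := ENNReal.Tendsto.mul_const
      (ENNReal.Tendsto.const_mul h (.inr (ENNReal.natCast_ne_top N))) (b := C) (.inr hC)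
    simpa using h'
  have hε2 : 0 < ε / 2 := ENNReal.half_pos hε.ne'
  obtain ⟨J, hJ⟩ := ((tendsto_order.1 hJ).2 _ hε2).exists
  have hsum : Tendsto (fun m => (N : ℝ≥0∞) * ∑ j ∈ Finset.range J,
      pairing (level (j + 1)) ((killedStep A)^[m] f)) atTop (𝓝 0) := by
    have h := ENNReal.Tendsto.const_mul (tendsto_finsetSum (Finset.range J) fun j _ => hlevel j)
      (.inr (ENNReal.natCast_ne_top N))
    simpa using h
  obtain ⟨m₀, hm₀⟩ := eventually_atTop.1 ((tendsto_order.1 hsum).2 _ hε2)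
  refine ⟨m₀, fun m hm => ?_⟩
  calc _ ≤ pairing ((N : ℝ≥0∞) • ∑ j ∈ Finset.range J, level (j + 1) +
      ((N : ℝ≥0∞) * ((J + 1 : ℕ) : ℝ≥0∞)⁻¹) • cutHeight (J + 1)) ((killedStep A)^[m] f) :=
        pairing_mono (hsplit J) le_rfl
    _ = (N : ℝ≥0∞) * ∑ j ∈ Finset.range J, pairing (level (j + 1)) ((killedStep A)^[m] f) +
        (N : ℝ≥0∞) * ((J + 1 : ℕ) : ℝ≥0∞)⁻¹ * pairing (cutHeight (J + 1)) ((killedStep A)^[m] f) := by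
        rw [pairing_add_left, pairing_smul_left, pairing_smul_left, pairing_sum_left]
    _ ≤ ε / 2 + ε / 2 := by
        refine add_le_add (hm₀ m hm).le (le_trans ?_ hJ.le)
        gcongr
        exact (pairing_iterate_le hf (hsup J) m).trans (hfC _)
    _ = ε := ENNReal.add_halves ε

/-- If `W` is superharmonic off `A` and dominates the cut-off height on `A`, then the number of
visits to the line `N` is at least four times the mean excess of the cut-off height over `W`. -/
lemma pairing_cutHeight_le (hA : line 0 ⊆ A) (hf : ∀ z ∈ A, f z = 0) {C : ℝ≥0∞} (hC : C ≠ ⊤)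
    (hfC : ∀ N, pairing (cutHeight N) f ≤ C) {W : ℤ × ℤ → ℝ≥0∞} (hW : ∀ z ∉ A, avg W z ≤ W z)
    {N : ℕ} (hN : 1 ≤ N) (hWA : ∀ z ∈ A, cutHeight N z ≤ W z) (hWf : pairing W f ≠ ⊤) :
    pairing (cutHeight N) f ≤ pairing W f + 4⁻¹ * lineGreen A N f := by
  set F : ℕ → ℤ × ℤ → ℝ≥0∞ := fun m => (killedStep A)^[m] f with hF
  have hFA : ∀ m, ∀ z ∈ A, F m z = 0 := iterate_killedStep_of_mem hf
  have hsup : ∀ z ∉ A, avg (cutHeight N) z ≤ cutHeight N z := fun z hz =>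
    le_self_add.trans (avg_cutHeight_add hN fun h => hz (hA h)).le
  have hWfin : ∀ m, pairing W (F m) ≠ ⊤ := fun m =>
    ne_top_of_le_ne_top hWf (pairing_iterate_le hf hW m)
  have hφfin : ∀ m, pairing (cutHeight N) (F m) ≠ ⊤ := fun m =>
    ne_top_of_le_ne_top hC ((pairing_iterate_le hf hsup m).trans (hfC N))
  have split : ∀ φ g : ℤ × ℤ → ℝ≥0∞,
      pairing φ (avg g) = pairing φ (killedStep A g) + pairing (A.indicator φ) (avg g) := by
    intro φ g
    simp only [pairing, ← ENNReal.tsum_add]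
    refine tsum_congr fun z => ?_
    by_cases hz : z ∈ A <;> simp [killedStep, hz]
  have step : ∀ m, pairing (cutHeight N) (F m) + pairing W (F (m + 1)) ≤
      pairing (cutHeight N) (F (m + 1)) + pairing W (F m) + 4⁻¹ * pairing (level N) (F m) := by
    intro m
    have hs : F (m + 1) = killedStep A (F m) := Function.iterate_succ_apply' _ _ _
    rw [hs]
    set g := F m
    calc pairing (cutHeight N) g + pairing W (killedStep A g)
        ≤ pairing (avg (cutHeight N) + (4⁻¹ : ℝ≥0∞) • level N) g + pairing W (killedStep A g) := by
          gcongr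
          exact pairing_mono_on (hFA m) fun z hz =>
            (avg_cutHeight_add hN fun h => hz (hA h)).ge
      _ = pairing (cutHeight N) (killedStep A g) + (pairing (A.indicator (cutHeight N)) (avg g) +
          pairing W (killedStep A g)) + 4⁻¹ * pairing (level N) g := by
          rw [pairing_add_left, pairing_smul_left, ← pairing_avg, split]
          ring
      _ ≤ pairing (cutHeight N) (killedStep A g) + (pairing (A.indicator W) (avg g) +
          pairing W (killedStep A g)) + 4⁻¹ * pairing (level N) g := by
          gcongr
          refine pairing_mono (fun z => ?_) le_rfl
          by_cases hz : z ∈ A <;> simp [hz, hWA]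
      _ = pairing (cutHeight N) (killedStep A g) + pairing (avg W) g +
          4⁻¹ * pairing (level N) g := by
          rw [← pairing_avg, split W]
          ring
      _ ≤ _ := by
          gcongr
          exact pairing_mono_on (hFA m) hW
  have key : ∀ m, pairing (cutHeight N) f + pairing W (F m) ≤ pairing (cutHeight N) (F m) +
      pairing W f + ∑ n ∈ Finset.range m, 4⁻¹ * pairing (level N) (F n) := by
    intro m
    induction m with
    | zero => simp [hF]
    | succ m ih =>
      have h := add_le_add ih (step m)
      rw [Finset.sum_range_succ]
      refine (ENNReal.add_le_add_iff_left
        (ENNReal.add_ne_top.2 ⟨hWfin m, hφfin m⟩)).1 (le_trans (le_of_eq ?_) (h.trans (le_of_eq ?_)))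
      <;> ring
  have hlim : Tendsto (fun m => pairing (cutHeight N) (F m) +
      (pairing W f + 4⁻¹ * lineGreen A N f)) atTop
      (𝓝 (0 + (pairing W f + 4⁻¹ * lineGreen A N f))) :=
    (tendsto_pairing_cutHeight hA hf hC hfC N).add_const _
  rw [zero_add] at hlim
  refine ge_of_tendsto' hlim fun m => le_self_add.trans ((key m).trans ?_)
  rw [add_assoc, lineGreen, ← ENNReal.tsum_mul_left]
  gcongr
  exact ENNReal.sum_le_tsum _

end

/-! ### A harmonic function growing like a power -/

/-- The root `ρ ∈ (0, 1]` of `ρ + ρ⁻¹ = 2 (2 - cos b)`, for which `ρ ^ |z₂| * cos (b * z₁)` is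
discrete harmonic off the horizontal axis. -/
noncomputable def decayRate (b : ℝ) : ℝ := (2 - Real.cos b) - √((2 - Real.cos b) ^ 2 - 1)

lemma decayRate_nonneg (b : ℝ) : 0 ≤ decayRate b := by
  have h1 := Real.cos_le_one b
  rw [decayRate, sub_nonneg, Real.sqrt_le_left (by linarith)]
  linarith

lemma decayRate_le_one (b : ℝ) : decayRate b ≤ 1 := by
  have h1 := Real.cos_le_one b
  have : 1 - Real.cos b ≤ √((2 - Real.cos b) ^ 2 - 1) := by
    refine Real.le_sqrt_of_sq_le ?_
    nlinarith
  rw [decayRate]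
  linarith

lemma decayRate_sq_add_one (b : ℝ) :
    decayRate b ^ 2 + 1 = 2 * (2 - Real.cos b) * decayRate b := by
  have h1 := Real.cos_le_one b
  have h2 : √((2 - Real.cos b) ^ 2 - 1) ^ 2 = (2 - Real.cos b) ^ 2 - 1 :=
    Real.sq_sqrt (by nlinarith)
  rw [decayRate]
  linear_combination h2

lemma one_sub_decayRate_le {b : ℝ} (hb : 0 ≤ b) : 1 - decayRate b ≤ 2 * b := by
  have h1 := Real.cos_le_one b
  have h2 := Real.neg_one_le_cos b
  have h3 := Real.one_sub_sq_div_two_le_cos (x := b)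
  have : √((2 - Real.cos b) ^ 2 - 1) ≤ 2 * b := by
    rw [Real.sqrt_le_left (by linarith)]
    nlinarith
  rw [decayRate]
  linarith

/-- The nonnegative function `1 - ρ ^ |z₂| * cos (b * z₁)`, discrete harmonic off the
horizontal axis. -/
noncomputable def wave (b : ℝ) (z : ℤ × ℤ) : ℝ :=
  1 - decayRate b ^ z.2.natAbs * Real.cos (b * z.1)

lemma wave_ge (b : ℝ) (z : ℤ × ℤ) : 1 - |Real.cos (b * z.1)| ≤ wave b z := by
  have h : decayRate b ^ z.2.natAbs * Real.cos (b * z.1) ≤ 1 * |Real.cos (b * z.1)| :=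
    (mul_le_mul_of_nonneg_left (le_abs_self _) (pow_nonneg (decayRate_nonneg b) _)).trans
      (mul_le_mul_of_nonneg_right (pow_le_one₀ (decayRate_nonneg b) (decayRate_le_one b))
        (abs_nonneg _))
  rw [wave]
  linarith

lemma wave_nonneg (b : ℝ) (z : ℤ × ℤ) : 0 ≤ wave b z :=
  (sub_nonneg.2 (Real.abs_cos_le_one _)).trans (wave_ge b z)

lemma wave_harmonic (b : ℝ) {z : ℤ × ℤ} (hz : z.2 ≠ 0) :
    wave b (z + (1, 0)) + wave b (z + (-1, 0)) + wave b (z + (0, 1)) + wave b (z + (0, -1)) =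
      4 * wave b z := by
  have hρ := decayRate_sq_add_one b
  have hv : decayRate b ^ (z.2 + 1).natAbs + decayRate b ^ (z.2 + -1).natAbs =
      2 * (2 - Real.cos b) * decayRate b ^ z.2.natAbs := by
    obtain ⟨m, hm⟩ : ∃ m, z.2.natAbs = m + 1 := ⟨z.2.natAbs - 1, by omega⟩
    rcases lt_or_gt_of_ne hz with h | h
    · rw [show (z.2 + 1).natAbs = m by omega, show (z.2 + -1).natAbs = m + 2 by omega, hm]
      linear_combination decayRate b ^ m * hρ
    · rw [show (z.2 + 1).natAbs = m + 2 by omega, show (z.2 + -1).natAbs = m by omega, hm]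
      linear_combination decayRate b ^ m * hρ
  have hh : Real.cos (b * ((z.1 + 1 : ℤ) : ℝ)) + Real.cos (b * ((z.1 + -1 : ℤ) : ℝ)) =
      2 * Real.cos b * Real.cos (b * z.1) := by
    push_cast
    rw [mul_add, mul_add, mul_neg, mul_one, Real.cos_add, ← sub_eq_add_neg, Real.cos_sub]
    ring
  simp only [wave, Prod.fst_add, Prod.snd_add, add_zero]
  linear_combination -Real.cos (b * z.1) * hv - decayRate b ^ z.2.natAbs * hh

/-- A nonnegative function, discrete harmonic off the horizontal axis. For `0 < β < 1` it is at
least `K + |z₁| ^ β` everywhere but grows sublinearly along the vertical axis. -/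
noncomputable def barrier (β : ℝ) (K : ℕ) (z : ℤ × ℤ) : ℝ≥0∞ :=
  K + 5 * ∑' k : ℕ, ENNReal.ofReal (((2 : ℝ) ^ k) ^ β * wave ((2 ^ k)⁻¹) z)

lemma avg_barrier (β : ℝ) (K : ℕ) {z : ℤ × ℤ} (hz : z.2 ≠ 0) :
    avg (barrier β K) z = barrier β K z := by
  set s : ℤ × ℤ → ℝ≥0∞ := fun z =>
    ∑' k : ℕ, ENNReal.ofReal (((2 : ℝ) ^ k) ^ β * wave ((2 ^ k)⁻¹) z) with hs
  have hsum : s (z + (1, 0)) + s (z + (-1, 0)) + s (z + (0, 1)) + s (z + (0, -1)) = 4 * s z := by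
    simp only [hs, ← ENNReal.tsum_add, ← ENNReal.tsum_mul_left]
    refine tsum_congr fun k => ?_
    have h0 : ∀ y, 0 ≤ ((2 : ℝ) ^ k) ^ β * wave ((2 ^ k)⁻¹) y := fun y =>
      mul_nonneg (by positivity) (wave_nonneg _ _)
    rw [← ENNReal.ofReal_add (h0 _) (h0 _), ← ENNReal.ofReal_add (add_nonneg (h0 _) (h0 _)) (h0 _),
      ← ENNReal.ofReal_add (add_nonneg (add_nonneg (h0 _) (h0 _)) (h0 _)) (h0 _),
      ← mul_add, ← mul_add, ← mul_add, wave_harmonic _ hz,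
      show (4 : ℝ≥0∞) = ENNReal.ofReal 4 by norm_num, ← ENNReal.ofReal_mul (by norm_num)]
    congr 1
    ring
  have hb : ∀ y, barrier β K y = K + 5 * s y := fun y => rfl
  simp only [avg, hb]
  calc _ = 4⁻¹ * (4 * K + 5 *
        (s (z + (1, 0)) + s (z + (-1, 0)) + s (z + (0, 1)) + s (z + (0, -1)))) := by ring
    _ = (4⁻¹ * 4) * (K + 5 * s z) := by
        rw [hsum]
        ring
    _ = _ := by rw [ENNReal.inv_mul_cancel (by norm_num) (by norm_num), one_mul]

lemma natCast_le_barrier (β : ℝ) (K : ℕ) (z : ℤ × ℤ) : (K : ℝ≥0∞) ≤ barrier β K z :=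
  le_self_add

lemma abs_cos_le {t : ℝ} (h1 : 1 ≤ t) (h2 : t ≤ 2) : |Real.cos t| ≤ 5 / 9 := by
  have hπ := Real.pi_gt_three
  have hc1 := Real.cos_one_le
  have hc1' := Real.one_sub_sq_div_two_le_cos (x := 1)
  have ht1 : Real.cos t ≤ Real.cos 1 :=
    Real.cos_le_cos_of_nonneg_of_le_pi zero_le_one (by linarith) h1
  have ht2 : Real.cos 2 ≤ Real.cos t :=
    Real.cos_le_cos_of_nonneg_of_le_pi (by linarith) (by linarith) h2
  have hc2 : Real.cos 2 = 2 * Real.cos 1 ^ 2 - 1 := by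
    rw [← Real.cos_two_mul]
    norm_num
  rw [abs_le]
  constructor <;> nlinarith

lemma rpow_le_barrier {β : ℝ} (hβ0 : 0 < β) (hβ1 : β < 1) (K : ℕ) (z : ℤ × ℤ) :
    ENNReal.ofReal (|(z.1 : ℝ)| ^ β) ≤ barrier β K z := by
  by_cases hz : z.1 = 0
  · simp [hz, Real.zero_rpow hβ0.ne']
  -- The term of the dyadic scale of `|z₁|` already suffices.
  set n := z.1.natAbs with hn
  have hn0 : n ≠ 0 := by omega
  set k := Nat.log 2 n
  have hk1 : (2 : ℝ) ^ k ≤ n := by exact_mod_cast Nat.pow_log_le_self 2 hn0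
  have hk2 : (n : ℝ) ≤ 2 * 2 ^ k := by
    have := (Nat.lt_pow_succ_log_self one_lt_two n).le
    rw [pow_succ'] at this
    exact_mod_cast this
  have habs : |(z.1 : ℝ)| = n := by
    rw [hn, Nat.cast_natAbs, Int.cast_abs]
  have hp : (0 : ℝ) < 2 ^ k := by positivity
  have hcos : |Real.cos ((2 ^ k)⁻¹ * z.1)| ≤ 5 / 9 := by
    rw [← Real.cos_abs, abs_mul, habs, abs_of_pos (inv_pos.2 hp), inv_mul_eq_div]
    exact abs_cos_le ((one_le_div hp).2 hk1) ((div_le_iff₀ hp).2 hk2)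
  have hpow : (n : ℝ) ^ β ≤ 2 * ((2 : ℝ) ^ k) ^ β := by
    calc (n : ℝ) ^ β ≤ (2 * 2 ^ k) ^ β := Real.rpow_le_rpow (by positivity) hk2 hβ0.le
      _ = 2 ^ β * (2 ^ k) ^ β := Real.mul_rpow (by norm_num) hp.le
      _ ≤ 2 * (2 ^ k) ^ β := by
        gcongr
        calc (2 : ℝ) ^ β ≤ 2 ^ (1 : ℝ) := Real.rpow_le_rpow_of_exponent_le (by norm_num) hβ1.le
          _ = 2 := Real.rpow_one 2
  have hterm : (n : ℝ) ^ β ≤ 5 * (((2 : ℝ) ^ k) ^ β * wave ((2 ^ k)⁻¹) z) := by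
    have hw := wave_ge ((2 ^ k)⁻¹) z
    have hq : (0 : ℝ) < (2 ^ k) ^ β := by positivity
    have : (4 / 9 : ℝ) ≤ wave ((2 ^ k)⁻¹) z := by linarith
    nlinarith
  rw [habs, barrier]
  refine le_trans (ENNReal.ofReal_le_ofReal hterm) (le_trans ?_ le_add_self)
  rw [ENNReal.ofReal_mul (by norm_num), show ENNReal.ofReal 5 = 5 by norm_num]
  gcongr
  exact ENNReal.le_tsum k

/-- On the vertical axis the barrier is eventually below the height. -/
lemma eventually_barrier_lt {β : ℝ} (hβ0 : 0 < β) (hβ1 : β < 1) (K : ℕ) :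
    ∀ᶠ M : ℕ in atTop, barrier β K (0, (M : ℤ)) < M := by
  set g : ℕ → ℕ → ℝ := fun M k => ((2 : ℝ) ^ k) ^ β * wave ((2 ^ k)⁻¹) (0, (M : ℤ)) with hg
  have hg0 : ∀ M k, 0 ≤ g M k := fun M k => mul_nonneg (by positivity) (wave_nonneg _ _)
  have hgM : ∀ M k, g M k ≤ ((2 : ℝ) ^ k) ^ β * (M * (2 * (2 ^ k)⁻¹)) := by
    intro M k
    refine mul_le_mul_of_nonneg_left ?_ (by positivity)
    have hb : (0 : ℝ) ≤ (2 ^ k)⁻¹ := by positivity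
    have h1 := one_sub_decayRate_le hb
    have h2 := one_add_mul_le_pow (a := decayRate ((2 ^ k)⁻¹) - 1)
      (by linarith [decayRate_nonneg ((2 ^ k)⁻¹)]) M
    have h3 : (M : ℝ) * (1 - decayRate ((2 ^ k)⁻¹)) ≤ M * (2 * (2 ^ k)⁻¹) := by gcongr
    rw [add_sub_cancel] at h2
    simp only [wave, Int.natAbs_natCast, Int.cast_zero, mul_zero, Real.cos_zero, mul_one]
    linarith
  have hg1 : ∀ M k, g M k ≤ ((2 : ℝ) ^ k) ^ β := by
    intro M k
    have : wave ((2 ^ k)⁻¹) (0, (M : ℤ)) ≤ 1 := by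
      simp only [wave, Int.natAbs_natCast, Int.cast_zero, mul_zero, Real.cos_zero, mul_one]
      linarith [pow_nonneg (decayRate_nonneg ((2 ^ k)⁻¹)) M]
    exact mul_le_of_le_one_right (by positivity) this
  have hgeo : ∀ k : ℕ, ((2 : ℝ) ^ k) ^ β * (2 * (2 ^ k)⁻¹) = 2 * (2 ^ (β - 1)) ^ k := by
    intro k
    rw [← Real.rpow_natCast 2 k, ← Real.rpow_mul (by norm_num), ← Real.rpow_natCast _ k,
      ← Real.rpow_mul (by norm_num), ← Real.rpow_neg (by norm_num), mul_left_comm,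
      ← Real.rpow_add (by norm_num)]
    congr 2
    ring
  have hsum : Summable fun k : ℕ => (2 : ℝ) * (2 ^ (β - 1)) ^ k :=
    (summable_geometric_of_lt_one (by positivity)
      (Real.rpow_lt_one_of_one_lt_of_neg one_lt_two (by linarith))).mul_left 2
  have hgsum : ∀ M, Summable (g M) := fun M => by
    refine Summable.of_nonneg_of_le (hg0 M) (fun k => ?_) (hsum.mul_left (M : ℝ))
    rw [← hgeo, mul_left_comm]
    exact hgM M k
  have hlim : Tendsto (fun M : ℕ => ∑' k, g M k / M) atTop (𝓝 (∑' _ : ℕ, (0 : ℝ))) := by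
    refine tendsto_tsum_of_dominated_convergence hsum (fun k => ?_) ?_
    · refine squeeze_zero (fun M => div_nonneg (hg0 M k) M.cast_nonneg)
        (fun M => div_le_div_of_nonneg_right (hg1 M k) M.cast_nonneg) ?_
      exact tendsto_const_div_atTop_nhds_zero_nat _
    · filter_upwards [eventually_gt_atTop 0] with M hM k
      have hM' : (0 : ℝ) < M := by exact_mod_cast hM
      rw [Real.norm_of_nonneg (div_nonneg (hg0 M k) hM'.le), div_le_iff₀ hM', ← hgeo]
      calc _ ≤ _ := hgM M k
        _ = _ := by ring
  have hK : Tendsto (fun M : ℕ => (K : ℝ) / M + 5 * ∑' k, g M k / M) atTop (𝓝 0) := by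
    simpa using (tendsto_const_div_atTop_nhds_zero_nat (K : ℝ)).add (hlim.const_mul 5)
  filter_upwards [eventually_gt_atTop 0, (tendsto_order.1 hK).2 1 one_pos] with M hM hlt
  have hM' : (0 : ℝ) < M := by exact_mod_cast hM
  rw [tsum_div_const, mul_div_assoc', ← add_div, div_lt_one hM'] at hlt
  have heq : barrier β K (0, (M : ℤ)) = ENNReal.ofReal (K + 5 * ∑' k, g M k) := by
    rw [ENNReal.ofReal_add K.cast_nonneg (mul_nonneg (by norm_num) (tsum_nonneg (hg0 M))),
      ENNReal.ofReal_mul (by norm_num), ENNReal.ofReal_tsum_of_nonneg (hg0 M) (hgsum M),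
      ENNReal.ofReal_natCast, show ENNReal.ofReal 5 = 5 by norm_num]
    rfl
  rw [heq, ← ENNReal.ofReal_natCast M]
  exact (ENNReal.ofReal_lt_ofReal_iff hM').2 hlt

/-! ### Harmonic measure as a Green's function -/

/-- By reversibility, the harmonic measure of `x` from level `N` is the expected number of
visits to that level of the killed walk leaving `x`. -/
lemma harmonicMeasureFrom_eq_lineGreen {B : Set (ℤ × ℤ)} {x : ℤ × ℤ} (hx : x ∈ B) {N : ℕ}
    (hxN : x.2 < N) :
    harmonicMeasureFrom B N x =
      lineGreen (B ∪ line 0) N (killedStep (B ∪ line 0) (({x} : Set (ℤ × ℤ)).indicator 1)) := by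
  set A := B ∪ line 0 with hA
  set F : ℕ → ℤ × ℤ → ℝ≥0∞ := fun n =>
    (killedStep A)^[n] (killedStep A (({x} : Set (ℤ × ℤ)).indicator 1)) with hF
  have hxA : x ∈ A := Or.inl hx
  have hhit : ∀ n, hitAt A x (n + 1) = F n := by
    intro n
    induction n with
    | zero => rw [hitAt_succ hxA, hitAt_zero hxA]; rfl
    | succ n ih =>
      rw [hitAt_succ hxA, ih]
      exact (Function.iterate_succ_apply' _ _ _).symm
  have hz : ∀ z, (line (N : ℤ) \ B).indicator (fun z => hitProb z A x) z =
      ∑' n, level N z * F n z := by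
    intro z
    by_cases hzN : z ∈ line (N : ℤ)
    · have hzN' : z.2 = N := hzN
      by_cases hzB : z ∈ B
      · have h0 : ∀ n, F n z = 0 := fun n =>
          iterate_killedStep_of_mem (fun _ => killedStep_of_mem) n z (Or.inl hzB)
        simp [hzB, h0]
      · have hzx : z ≠ x := by
          rintro rfl
          exact hzB hx
        rw [Set.indicator_of_mem (show z ∈ line (N : ℤ) \ B from ⟨hzN, hzB⟩), hitProb_eq_tsum hxA,
          tsum_eq_zero_add' ENNReal.summable, hitAt_zero hxA]
        simp [hhit, level, hzN, hzx]
    · simp [level, hzN]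
  rw [harmonicMeasureFrom, tsum_subtype (line (N : ℤ) \ B) (fun z => hitProb z A x)]
  simp only [hz]
  rw [ENNReal.tsum_comm]
  rfl

/-- The number of visits to the line of height `N` eventually decreases in `N`. -/
lemma exists_tendsto_lineGreen {A : Set (ℤ × ℤ)} {f : ℤ × ℤ → ℝ≥0∞} (hA : line 0 ⊆ A)
    (hf : ∀ z ∈ A, f z = 0) {N₀ : ℕ} (hN₀ : 1 ≤ N₀) (hfN : ∀ z, (N₀ : ℤ) < z.2 → f z = 0)
    (hfin : pairing (cutHeight N₀) f ≠ ⊤) :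
    ∃ h : ℝ≥0, Tendsto (fun N => lineGreen A N f) atTop (𝓝 (h : ℝ≥0∞)) := by
  have hanti : Antitone fun n => lineGreen A (n + N₀) f := antitone_nat_of_succ_le fun n => by
    rw [show n + 1 + N₀ = n + N₀ + 1 by ring]
    exact lineGreen_succ_le fun z hz => hfN z (lt_of_le_of_lt (by push_cast; omega) hz)
  have hlim := tendsto_atTop_iInf hanti
  have h0 : lineGreen A (0 + N₀) f ≠ ⊤ := by
    rw [zero_add]
    intro htop
    have h := lineGreen_le hA hf hN₀
    rw [htop, ENNReal.mul_top (by norm_num)] at h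
    exact hfin (top_le_iff.1 h)
  refine ⟨(⨅ n, lineGreen A (n + N₀) f).toNNReal, ?_⟩
  rw [ENNReal.coe_toNNReal (ne_top_of_le_ne_top h0 (iInf_le _ 0))]
  exact (tendsto_add_atTop_iff_nat N₀).1 hlim

/-- A site that the walk can reach before hitting `A` transmits a fixed fraction of its line
visits. -/
lemma mul_lineGreen_le (A : Set (ℤ × ℤ)) (f : ℤ × ℤ → ℝ≥0∞) (n : ℕ) (y : ℤ × ℤ) (N : ℕ) :
    (killedStep A)^[n] f y * lineGreen A N (({y} : Set (ℤ × ℤ)).indicator 1) ≤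
      lineGreen A N f := by
  have hle : (killedStep A)^[n] f y • ({y} : Set (ℤ × ℤ)).indicator 1 ≤ (killedStep A)^[n] f := by
    intro z
    by_cases hz : z = y
    · simp [hz]
    · simp [hz]
  rw [lineGreen, ← ENNReal.tsum_mul_left]
  calc _ ≤ ∑' m, pairing (level N) ((killedStep A)^[m + n] f) := by
        refine ENNReal.tsum_le_tsum fun m => ?_
        rw [← pairing_smul_right, ← iterate_killedStep_smul, Function.iterate_add_apply]
        exact pairing_mono le_rfl (iterate_killedStep_mono A hle m)
    _ ≤ _ := ENNReal.tsum_comp_le_tsum_of_injective (add_left_injective n)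
        (fun m => pairing (level N) ((killedStep A)^[m] f))

/-! ### Connecting to the vertical axis -/

/-- The killed walk with initial distribution `f` visits `y` with positive probability. -/
def Reaches (A : Set (ℤ × ℤ)) (f : ℤ × ℤ → ℝ≥0∞) (y : ℤ × ℤ) : Prop :=
  ∃ n, 0 < (killedStep A)^[n] f y

lemma killedStep_pos {A : Set (ℤ × ℤ)} {f : ℤ × ℤ → ℝ≥0∞} {y y' : ℤ × ℤ} (hy' : y' ∉ A)
    (hy : 0 < f y) (h : y' + (1, 0) = y ∨ y' + (-1, 0) = y ∨ y' + (0, -1) = y) :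
    0 < killedStep A f y' := by
  rw [killedStep, Set.indicator_of_mem (by exact hy'), avg]
  refine ENNReal.mul_pos (by norm_num) (ne_of_gt ?_)
  rcases h with h | h | h <;> rw [h] <;> positivity

lemma Reaches.step {A : Set (ℤ × ℤ)} {f : ℤ × ℤ → ℝ≥0∞} {y y' : ℤ × ℤ} (hy : Reaches A f y)
    (hy' : y' ∉ A) (h : y' + (1, 0) = y ∨ y' + (-1, 0) = y ∨ y' + (0, -1) = y) :
    Reaches A f y' := by
  obtain ⟨n, hn⟩ := hy
  refine ⟨n + 1, ?_⟩
  rw [Function.iterate_succ_apply']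
  exact killedStep_pos hy' hn h

lemma Reaches.up {A : Set (ℤ × ℤ)} {f : ℤ × ℤ → ℝ≥0∞} {k h : ℤ} (hr : Reaches A f (k, h))
    (hA : ∀ j, h < j → (k, j) ∉ A) (n : ℕ) : Reaches A f (k, h + n) := by
  induction n with
  | zero => simpa using hr
  | succ n ih =>
    refine ih.step (hA _ (by push_cast; omega)) (Or.inr (Or.inr ?_))
    ext <;> simp
    ring

lemma Reaches.to_axis {A : Set (ℤ × ℤ)} {f : ℤ × ℤ → ℝ≥0∞} {M : ℤ} (n : ℕ)
    (hA : ∀ i : ℤ, i.natAbs ≤ n → (i, M) ∉ A) :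
    ∀ i : ℤ, i.natAbs = n → Reaches A f (i, M) → Reaches A f (0, M) := by
  induction n with
  | zero =>
    intro i hi hr
    rwa [Int.natAbs_eq_zero.1 hi] at hr
  | succ n ih =>
    intro i hi hr
    have ih' := ih fun j hj => hA j (by omega)
    rcases lt_or_ge i 0 with h0 | h0
    · exact ih' (i + 1) (by omega) (hr.step (hA _ (by omega)) (Or.inr (Or.inl (by simp))))
    · exact ih' (i - 1) (by omega) (hr.step (hA _ (by omega)) (Or.inl (by simp)))

end StationaryHM

open StationaryHM in
theorem theorem2 (B : Set (ℤ × ℤ)) (hB : B ⊆ StationaryHM.halfPlane) (hne : B.Nonempty)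
    (hα : ∃ α : ℝ, 1 < α ∧
      (B \ {x | x ∈ StationaryHM.halfPlane ∧ (x.2 : ℝ) ≤ |(x.1 : ℝ)| ^ (1 / α)}).Finite) :
    ∃ x ∈ B, ∃ h : ℝ≥0, 0 < h ∧ StationaryHM.HasStationaryHarmonicMeasure B x h := by
  obtain ⟨α, hα1, hfin⟩ := hα
  set β : ℝ := 1 / α with hβ
  have hβ0 : 0 < β := by positivity
  have hβ1 : β < 1 := (div_lt_one (by linarith)).2 hα1
  -- `K` bounds the heights of the finitely many sites above the curve.
  obtain ⟨K, hK⟩ : ∃ K : ℕ, ∀ z ∈ B, z.2 ≤ K ∨ (z.2 : ℝ) ≤ |(z.1 : ℝ)| ^ β := by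
    obtain ⟨K, hK⟩ := (hfin.image fun z => z.2.toNat).bddAbove
    refine ⟨K, fun z hz => or_iff_not_imp_right.2 fun h => ?_⟩
    have hzK : z.2.toNat ≤ K :=
      hK (Set.mem_image_of_mem (fun z : ℤ × ℤ => z.2.toNat)
        (Set.mem_sdiff_of_mem hz fun h' => h h'.2))
    omega
  obtain ⟨b, hb⟩ := hne
  set k : ℤ := b.1 with hk
  obtain ⟨R, hR⟩ : ∃ R : ℕ, |(k : ℝ)| ^ β < R := exists_nat_gt _
  have hclear : ∀ i j : ℤ, i.natAbs ≤ k.natAbs → (K : ℤ) < j → (R : ℤ) ≤ j → (i, j) ∉ B := by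
    intro i j hi hj hj' hij
    rcases hK _ hij with h | h
    · simp only at h
      omega
    · have hi' : |(i : ℝ)| ≤ |(k : ℝ)| := by
        rw [← Int.cast_abs, ← Int.cast_abs, ← Nat.cast_natAbs, ← Nat.cast_natAbs]
        exact_mod_cast hi
      have h1 : |(i : ℝ)| ^ β ≤ |(k : ℝ)| ^ β := Real.rpow_le_rpow (abs_nonneg _) hi' hβ0.le
      have h2 : (R : ℝ) ≤ j := by exact_mod_cast hj'
      simp only at h
      linarith
  -- The highest site of `B` in the column of `b`.
  obtain ⟨x, ⟨hxB, hxk⟩, hxmax⟩ : ∃ x ∈ {z | z ∈ B ∧ z.1 = k}, ∀ z ∈ {z | z ∈ B ∧ z.1 = k},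
      z.2 ≤ x.2 := by
    refine Set.exists_max_image {z | z ∈ B ∧ z.1 = k} (fun z => z.2) ?_ ⟨b, hb, rfl⟩
    refine ((Set.finite_singleton k).prod (Set.finite_Icc (0 : ℤ) (K + R))).subset ?_
    rintro ⟨i, j⟩ ⟨hz, hik : i = k⟩
    refine ⟨hik, hB hz, ?_⟩
    by_contra! hj
    simp only at hj
    exact hclear i j (by omega) (by omega) (by omega) hz
  have hx0 : 0 ≤ x.2 := hB hxB
  set A : Set (ℤ × ℤ) := B ∪ line 0 with hA
  have hline : line 0 ⊆ A := Set.subset_union_right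
  have hnotA : ∀ z : ℤ × ℤ, z.2 ≠ 0 → z ∉ B → z ∉ A := fun z h0 hz => not_or.2 ⟨hz, h0⟩
  set δ : ℤ × ℤ → (ℤ × ℤ → ℝ≥0∞) := fun y => ({y} : Set (ℤ × ℤ)).indicator 1 with hδ
  set f := killedStep A (δ x) with hf
  have hfA : ∀ z ∈ A, f z = 0 := fun z hz => killedStep_of_mem hz
  -- The limit exists.
  set N₀ : ℕ := x.2.toNat + 1 with hN₀
  have hfN : ∀ z, (N₀ : ℤ) < z.2 → f z = 0 := by
    intro z hz
    have hne : ∀ e : ℤ × ℤ, -1 ≤ e.2 → δ x (z + e) = 0 := by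
      intro e he
      refine Set.indicator_of_notMem (fun h => ?_) _
      have := congrArg Prod.snd (Set.mem_singleton_iff.1 h)
      rw [Prod.snd_add] at this
      omega
    refine le_antisymm ((killedStep_le A _ z).trans ?_) zero_le
    rw [avg, hne _ (by norm_num), hne _ (by norm_num), hne _ (by norm_num), hne _ (by norm_num)]
    simp
  have hffin : pairing (cutHeight N₀) f ≠ ⊤ := by
    have h : pairing (cutHeight N₀) f ≤ avg (cutHeight N₀) x := by
      rw [← pairing_single (avg (cutHeight N₀)) x, ← pairing_avg]
      exact pairing_mono le_rfl (killedStep_le _ _)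
    refine ne_top_of_le_ne_top (ne_of_lt ?_) h
    simp only [avg, cutHeight]
    finiteness
  obtain ⟨h, hh⟩ := exists_tendsto_lineGreen hline hfA (Nat.le_add_left 1 _) hfN hffin
  refine ⟨x, hxB, h, ?_, hh.congr' ?_⟩
  swap
  · filter_upwards [eventually_ge_atTop N₀] with N hN
    exact (harmonicMeasureFrom_eq_lineGreen hxB (by omega)).symm
  -- The barrier lies below the height at a site `(0, M)`, which can be reached from `x`.
  obtain ⟨M, hMbar, hM⟩ := ((eventually_barrier_lt hβ0 hβ1 K).and
    (eventually_ge_atTop (K + R + N₀ + 1))).exists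
  set y : ℤ × ℤ := (0, (M : ℤ)) with hy
  have hrow : ∀ i : ℤ, i.natAbs ≤ k.natAbs → (i, (M : ℤ)) ∉ A := fun i hi =>
    hnotA _ (by simp only; omega) (hclear i M hi (by omega) (by omega))
  have hcol : ∀ j, x.2 < j → (k, j) ∉ A := fun j hj =>
    hnotA _ (by simp only; omega) fun h => absurd (hxmax (k, j) ⟨h, rfl⟩) (by simpa using hj)
  have hreach : Reaches A f y := by
    refine Reaches.to_axis _ hrow k rfl ?_
    have h1 : Reaches A f (k, x.2 + 1) := by
      refine ⟨0, killedStep_pos (hcol _ (by omega)) (y := x) (by simp [hδ]) (Or.inr (Or.inr ?_))⟩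
      ext <;> simp [hxk]
    have h2 := h1.up (fun j hj => hcol j (by omega)) (M - N₀)
    rwa [show x.2 + 1 + ((M - N₀ : ℕ) : ℤ) = M by omega] at h2
  obtain ⟨n, hn⟩ := hreach
  have hyA : ∀ z ∈ A, δ y z = 0 := by
    intro z hz
    refine Set.indicator_of_notMem (fun h => ?_) _
    rw [Set.mem_singleton_iff.1 h] at hz
    exact hrow 0 (by simp) hz
  have hbarA : ∀ N, ∀ z ∈ A, cutHeight N z ≤ barrier β K z := by
    intro N z hz
    have hle : cutHeight N z ≤ (z.2.toNat : ℝ≥0∞) := by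
      simp only [cutHeight]
      exact_mod_cast min_le_left _ _
    rcases hz with hz | hz
    · have hz0 : 0 ≤ z.2 := hB hz
      rcases hK z hz with h | h
      · refine (hle.trans ?_).trans (natCast_le_barrier β K z)
        exact_mod_cast (by omega : z.2.toNat ≤ K)
      · refine (hle.trans ?_).trans (rpow_le_barrier hβ0 hβ1 K z)
        rw [← ENNReal.ofReal_natCast]
        refine ENNReal.ofReal_le_ofReal (le_trans (le_of_eq ?_) h)
        exact_mod_cast Int.toNat_of_nonneg hz0
    · have : z.2 = 0 := hz
      simp [cutHeight, this]
  have hyM : ∀ N, pairing (cutHeight N) (δ y) ≤ M := by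
    intro N
    rw [pairing_single]
    simp [cutHeight, hy]
  have hlower : ∀ N ≥ M, (killedStep A)^[n] f y * (M - barrier β K y) ≤ lineGreen A N f := by
    intro N hN
    refine le_trans ?_ (mul_lineGreen_le A f n y N)
    gcongr
    have h1 := pairing_cutHeight_le hline hyA (ENNReal.natCast_ne_top M) hyM
      (W := barrier β K) (fun z hz => (avg_barrier β K fun h => hz (hline h)).le)
      (N := N) (by omega) (hbarA N) (by rw [pairing_single]; exact ne_top_of_lt hMbar)
    rw [pairing_single, pairing_single] at h1
    have h2 : cutHeight N y = M := by simp [cutHeight, hy, hN]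
    rw [h2] at h1
    refine (tsub_le_iff_left.2 h1).trans (mul_le_of_le_one_left zero_le ?_)
    exact ENNReal.inv_le_one.2 (by norm_num)
  have hpos : 0 < (killedStep A)^[n] f y * (M - barrier β K y) :=
    ENNReal.mul_pos hn.ne' (tsub_pos_of_lt hMbar).ne'
  have := ge_of_tendsto hh (eventually_atTop.2 ⟨M, hlower⟩)
  exact_mod_cast hpos.trans_le this
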